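/- Let $\mathrm{Hol}$ be the $\mathbb{C}$-algebra of holomorphic functions on the upper half plane and let $H=\bigoplus_{n\in\mathbb{R}}H_n$ with $H_n=\mathrm{Hol}$; the element of $H_n$ given by $f\in\mathrm{Hol}$ is written $(f,n)$, and $H$ is a graded $\mathbb{C}$-algebra with product $(f,n)(g,m)=(fg,n+m)$ and identity $(1,0)$. Let $E_2,E_4,E_6$ be the Eisenstein series for $\mathrm{SL}(2,\mathbb{Z})$ normalized to have constant term $1$, and define $\mathbb{C}$-linear endomorphisms of $H$ by $$\delta(f,n)=\Bigl(\tfrac{1}{2\pi i}\tfrac{df}{dz}-\tfrac{n}{12}E_2f,\;n+2\Bigr),\qquad e_4(f,n)=(E_4f,n+4),\qquad e_6(f,n)=(E_6f,n+6).$$ Let $\mathcal{R}$ be the $\mathbb{C}$-subalgebra of $\mathrm{End}_{\mathbb{C}}(H)$ generated by $\delta,e_4,e_6$, and for $k\in\mathbb{Z}$ let $\mathcal{R}_k$ be the set of $a\in\mathcal{R}$ with $a(H_n)\subset H_{n+k}$ for all $n\in\mathbb{R}$. An element of $\mathcal{R}$ is called monic if it has the form $\delta^n+a_{n-1}\delta^{n-1}+\cdots+a_1\delta+a_0$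 with $n\ge 0$ and all $a_i$ in the subalgebra $\mathbb{C}[e_4,e_6]$ generated by $e_4$ and $e_6$ (the algebra of modular forms for $\mathrm{SL}(2,\mathbb{Z})$ acting by multiplication). For $k\in\mathbb{R}$ put $$S_k=\{\phi\in H_k\mid a\phi=0\text{ for some monic }a\in\mathcal{R}\},$$ the set of weight-$k$ solutions of monic modular linear differential equations. For $k\in\mathbb{Z}$ let $\mathcal{M}_k\subset H_k$ be the space of all $(f,k)$ with $f$ a holomorphic modular form of weight $k$ for $\mathrm{SL}(2,\mathbb{Z})$. Theorem. 1. $S_k+S_k\subset S_k$ for all $k\in\mathbb{R}$. 2. $S_kS_l\subset S_{k+l}$ for all $k,l\in\mathbb{R}$. 3. $\mathcal{R}_kS_l\subset S_{k+l}$ for all $k\in\mathbb{Z}$ and $l\in\mathbb{R}$. 4. $\mathcal{M}_k\subset S_k$ for all $k\in\mathbb{Z}$. Moreover, $\bigoplus_{k\in\mathbb{R}}S_k\subset H$ (the set of elements of $H$ whose component in $H_k$ lies in $S_k$ for every $k\in\mathbb{R}$) is a $\mathbb{C}$-subalgebra and a left $\mathcal{R}$-submodule of $H$. -/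

import Mathlib

open scoped Manifold MatrixGroups ModularForm Pointwise UpperHalfPlane

noncomputable section

namespace MLDO

/-- The `ℂ`-algebra `Hol` of holomorphic functions on the upper half plane. -/
def Hol : Subalgebra ℂ (ℍ → ℂ) where
  carrier := {f | MDifferentiable 𝓘(ℂ) 𝓘(ℂ) f}
  mul_mem' hf hg := hf.mul hg
  add_mem' hf hg := hf.add hg
  algebraMap_mem' _ := mdifferentiable_const

/-- The Ramanujan-Serre operator `D_k f = (2πi)⁻¹ df/dz - (k/12) E₂ f` of weight `k`,
as a `ℂ`-linear endomorphism of `Hol`. -/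
def serreD (k : ℝ) : Hol →ₗ[ℂ] Hol where
  toFun f := ⟨Derivative.serreDerivative (k : ℂ) f.1,
    Derivative.serreDerivative_mdifferentiable _ f.2⟩
  map_add' f g := Subtype.ext (Derivative.serreDerivative_add _ _ _ f.2 g.2)
  map_smul' c f := Subtype.ext (Derivative.serreDerivative_smul _ c _ f.2)

/-- The algebra `H = ⨁_{n ∈ ℝ} H_n` with `H_n = Hol` and `(f, n) (g, m) = (f g, n + m)`. -/
abbrev H : Type := AddMonoidAlgebra Hol ℝ

/-- The homogeneous element `(f, n)` of weight `n`. -/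
abbrev hom (f : Hol) (n : ℝ) : H := AddMonoidAlgebra.single n f

/-- The homogeneous component `H_n` of weight `n`. -/
def degH (n : ℝ) : Set H := Set.range fun f : Hol => hom f n

/-- The holomorphic function underlying a modular form of weight `k` for `SL(2, ℤ)`. -/
def ofModularForm {k : ℤ} (f : ModularForm 𝒮ℒ k) : Hol := ⟨f, f.holo'⟩

/-- The derivation `δ (f, n) = (D_n f, n + 2)` of `H`. -/
def delta : Module.End ℂ H where
  toFun φ := φ.coeff.sum fun n f => hom (serreD n f) (n + 2)
  map_add' φ ψ := by
    rw [AddMonoidAlgebra.coeff_add]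
    exact Finsupp.sum_add_index' (by simp) (by intro n f g; simp)
  map_smul' c φ := by
    rw [AddMonoidAlgebra.coeff_smul, Finsupp.sum_smul_index' (by simp)]
    simp [Finsupp.smul_sum, AddMonoidAlgebra.smul_single]

theorem delta_hom (f : Hol) (n : ℝ) : delta (hom f n) = hom (serreD n f) (n + 2) := by
  simp [delta]

/-- Multiplication by the Eisenstein series of weight four: `e₄ (f, n) = (E₄ f, n + 4)`. -/
def e4 : Module.End ℂ H := LinearMap.mulLeft ℂ (hom (ofModularForm ModularForm.E₄) 4)

/-- Multiplication by the Eisenstein series of weight six: `e₆ (f, n) = (E₆ f, n + 6)`. -/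
def e6 : Module.End ℂ H := LinearMap.mulLeft ℂ (hom (ofModularForm ModularForm.E₆) 6)

theorem e4_hom (f : Hol) (n : ℝ) :
    e4 (hom f n) = hom (ofModularForm ModularForm.E₄ * f) (n + 4) := by
  simp [e4, AddMonoidAlgebra.single_mul_single, add_comm]

theorem e6_hom (f : Hol) (n : ℝ) :
    e6 (hom f n) = hom (ofModularForm ModularForm.E₆ * f) (n + 6) := by
  simp [e6, AddMonoidAlgebra.single_mul_single, add_comm]

/-- The algebra `𝓡` of modular linear differential operators. -/
def R : Subalgebra ℂ (Module.End ℂ H) := Algebra.adjoin ℂ {delta, e4, e6}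

/-- The homogeneous operators in `𝓡` of weight `k`: those that map `H_n` into `H_{n+k}`. -/
def degR (k : ℤ) : Set (Module.End ℂ H) :=
  {a | a ∈ R ∧ ∀ n : ℝ, ∀ φ ∈ degH n, a φ ∈ degH (n + k)}

/-- The algebra `ℂ[E₄, E₆]` of modular forms, acting on `H` by multiplication. -/
def coeffAlg : Subalgebra ℂ (Module.End ℂ H) := Algebra.adjoin ℂ {e4, e6}

/-- The space `𝓜_k ⊆ H_k` of holomorphic modular forms of weight `k` for `SL(2, ℤ)`. -/
def modularForms (k : ℤ) : Set H :=
  Set.range fun f : ModularForm 𝒮ℒ k => hom (ofModularForm f) k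

/-- The monic operators: `a = δ^n + a_{n-1} δ^{n-1} + ⋯ + a_1 δ + a_0` with `n ≥ 0` and
coefficients `a_i` in `ℂ[E₄, E₆]`. -/
def IsMonic (a : Module.End ℂ H) : Prop :=
  ∃ (n : ℕ) (c : Fin n → coeffAlg),
    a = delta ^ n + ∑ i : Fin n, (c i : Module.End ℂ H) * delta ^ (i : ℕ)

/-- The solutions `S_k ⊆ H_k` of weight `k` of the monic modular linear differential equations. -/
def S (k : ℝ) : Set H := {φ | φ ∈ degH k ∧ ∃ a ∈ R, IsMonic a ∧ a φ = 0}

/-- The direct sum `⨁_{k ∈ ℝ} S_k`: the elements of `H` all of whose components `(φ_k, k)`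
lie in `S_k`. -/
def sumS : Set H := {φ | ∀ k : ℝ, hom (φ.coeff k) k ∈ S k}

end MLDO

end

/-!
The ring `ℂ[E₄, E₆]` of modular forms, embedded in `H`, is noetherian, and it is stable under the
derivation `δ` because the Serre derivative of a modular form is a modular form. Over such a ring,
`φ` is annihilated by a monic operator if and only if it lies in a finitely generated submodule
stable under `δ`: a monic equation of order `n` makes the span of `φ, δφ, …, δⁿ⁻¹φ` stable, and
conversely, by noetherianity, some `δⁿφ` depends linearly on the lower derivatives. If `M` and `N`
are finitely generated and stable, then so are `M + N` and, by the Leibniz rule, `M N`. Hence the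
solutions form a `δ`-stable subalgebra of `H` containing the modular forms, and `⨁ S_k` is its
largest graded subalgebra.
-/

noncomputable section

namespace MLDO

section LevelOne

open DirectSum UpperHalfPlane ModularForm

theorem of_eq_of_coe_eq {k l : ℤ} (hkl : k = l) {f : ModularForm 𝒮ℒ k} {g : ModularForm 𝒮ℒ l}
    (hfg : ⇑f = ⇑g) : of (ModularForm 𝒮ℒ) k f = of (ModularForm 𝒮ℒ) l g := by
  subst hkl
  rw [DFunLike.ext' hfg]

theorem exists_discriminant_mul_eq_of_isCuspForm {k : ℤ} {f : ModularForm 𝒮ℒ k}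
    (hf : f.IsCuspForm) : ∃ g : ModularForm 𝒮ℒ (k - 12),
      of (ModularForm 𝒮ℒ) 12 CuspForm.discriminant * of (ModularForm 𝒮ℒ) (k - 12) g =
        of (ModularForm 𝒮ℒ) k f := by
  obtain ⟨h, rfl⟩ := hf
  refine ⟨CuspForm.discriminantEquiv h, ?_⟩
  rw [of_mul_of]
  exact of_eq_of_coe_eq (by ring) (discriminant_mul_discriminantEquiv h)

theorem exists_weight_eq_or_eq_zero (k : ℤ) :
    (∃ a b : ℕ, k = a * 4 + b * 6) ∨ ∀ f : ModularForm 𝒮ℒ k, f = 0 := by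
  rcases lt_or_ge k 0 with hneg | hnonneg
  · exact .inr (rank_zero_iff_forall_zero.mp (levelOne_neg_weight_rank_zero hneg))
  rcases Int.even_or_odd' k with ⟨m, rfl | rfl⟩
  · obtain rfl | hm := eq_or_ne m 1
    · exact .inr (rank_zero_iff_forall_zero.mp levelOne_weight_two_rank_zero)
    rcases Int.even_or_odd' m with ⟨r, rfl | rfl⟩
    · exact .inl ⟨r.toNat, 0, by lia⟩
    · exact .inl ⟨(r - 1).toNat, 1, by lia⟩
  · exact .inr (levelOne_odd_weight_eq_zero (odd_two_mul_add_one m))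

theorem coeff_zero_qExpansion_E₄_pow_mul_E₆_pow (a b : ℕ) :
    (qExpansion 1 ((E₄.pow a).mul (E₆.pow b))).coeff 0 = 1 := by
  have hE₄ : (qExpansion 1 E₄).coeff 0 = 1 := EisensteinSeries.E_qExpansion_coeff_zero _ ⟨2, rfl⟩
  have hE₆ : (qExpansion 1 E₆).coeff 0 = 1 := EisensteinSeries.E_qExpansion_coeff_zero _ ⟨3, rfl⟩
  rw [PowerSeries.coeff_zero_eq_constantCoeff_apply] at hE₄ hE₆ ⊢
  rw [ModularForm.qExpansion_mul one_pos one_mem_strictPeriods_SL,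
    ModularForm.qExpansion_pow one_pos one_mem_strictPeriods_SL,
    ModularForm.qExpansion_pow one_pos one_mem_strictPeriods_SL,
    map_mul, map_pow, map_pow, hE₄, hE₆, one_pow, one_pow, one_mul]

theorem of_mem_adjoin_E₄_E₆ {k : ℤ} (f : ModularForm 𝒮ℒ k) :
    of (ModularForm 𝒮ℒ) k f ∈
      Algebra.adjoin ℂ {of (ModularForm 𝒮ℒ) 4 E₄, of (ModularForm 𝒮ℒ) 6 E₆} := by
  -- `f - c E₄ᵃ E₆ᵇ` is a cusp form for a suitable `c`, and dividing it by `Δ` lowers the weight.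
  set B := Algebra.adjoin ℂ {of (ModularForm 𝒮ℒ) 4 E₄, of (ModularForm 𝒮ℒ) 6 E₆}
  have hE₄ : of (ModularForm 𝒮ℒ) 4 E₄ ∈ B := Algebra.subset_adjoin (by simp)
  have hE₆ : of (ModularForm 𝒮ℒ) 6 E₆ ∈ B := Algebra.subset_adjoin (by simp)
  obtain ⟨n, hn⟩ : ∃ n : ℕ, k < n := ⟨k.toNat + 1, by lia⟩
  induction n using Nat.strong_induction_on generalizing k with
  | _ n ih =>
    obtain ⟨a, b, rfl⟩ | hzero := exists_weight_eq_or_eq_zero k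
    · set g := (E₄.pow a).mul (E₆.pow b)
      obtain ⟨q, hq⟩ := exists_discriminant_mul_eq_of_isCuspForm
        (sub_smul_isCuspForm f g (coeff_zero_qExpansion_E₄_pow_mul_E₆_pow a b))
      have hg : of (ModularForm 𝒮ℒ) _ g ∈ B := by
        have := mul_mem (pow_mem hE₄ a) (pow_mem hE₆ b)
        rwa [directSum_of_pow, directSum_of_pow, of_mul_of] at this
      have hΔ : of (ModularForm 𝒮ℒ) 12 CuspForm.discriminant ∈ B := by
        rw [discriminant_eq_E₄_cube_sub_E₆_sq_graded]
        exact B.smul_mem (sub_mem (pow_mem hE₄ 3) (pow_mem hE₆ 2)) _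
      have hsub := mul_mem hΔ (ih (n - 1) (by lia) q (by lia))
      rw [hq, map_sub, of_smul] at hsub
      exact (sub_add_cancel (of (ModularForm 𝒮ℒ) _ f) _) ▸ add_mem hsub (B.smul_mem hg _)
    · rw [hzero f, map_zero]
      exact zero_mem B

theorem adjoin_E₄_E₆_eq_top :
    Algebra.adjoin ℂ {of (ModularForm 𝒮ℒ) 4 E₄, of (ModularForm 𝒮ℒ) 6 E₆} = ⊤ := by
  refine eq_top_iff.mpr fun f _ => ?_
  induction f using DirectSum.induction_on with
  | zero => exact zero_mem _
  | of k f => exact of_mem_adjoin_E₄_E₆ f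
  | add f g hf hg => exact add_mem (hf trivial) (hg trivial)

theorem norm_deriv_comp_ofComplex_le {f : ℍ → ℂ} (hf : MDifferentiable 𝓘(ℂ) 𝓘(ℂ) f) {A M : ℝ}
    (hA : 0 ≤ A) (hM : ∀ z : ℍ, A ≤ z.im → ‖f z‖ ≤ M) {z : ℍ} (hz : A + 1 < z.im) :
    ‖deriv (f ∘ ofComplex) z‖ ≤ M := by
  -- Cauchy's estimate on the unit circle around `z`
  have him {w : ℂ} (hw : w ∈ Metric.closedBall (z : ℂ) 1) : A < w.im := by
    have h := (Complex.abs_im_le_norm (w - z)).trans (mem_closedBall_iff_norm.mp hw)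
    rw [Complex.sub_im, coe_im] at h
    linarith [(abs_le.mp h).1]
  have hdiff : DiffContOnCl ℂ (f ∘ ofComplex) (Metric.ball (z : ℂ) 1) :=
    (UpperHalfPlane.mdifferentiable_iff.mp hf).diffContOnCl_ball fun w hw => hA.trans_lt (him hw)
  have hsphere : ∀ w ∈ Metric.sphere (z : ℂ) 1, ‖(f ∘ ofComplex) w‖ ≤ M := fun w hw => by
    have hw := him (Metric.sphere_subset_closedBall hw)
    rw [Function.comp_apply, ofComplex_apply_of_im_pos (hA.trans_lt hw)]
    exact hM _ hw.le
  simpa only [div_one] using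
    Complex.norm_deriv_le_of_forall_mem_sphere_norm_le one_pos hdiff hsphere

theorem isBoundedAtImInfty_normalizedDerivOfComplex {f : ℍ → ℂ}
    (hf : MDifferentiable 𝓘(ℂ) 𝓘(ℂ) f) (hb : IsBoundedAtImInfty f) :
    IsBoundedAtImInfty (Derivative.normalizedDerivOfComplex f) := by
  rw [isBoundedAtImInfty_iff] at hb ⊢
  obtain ⟨M, A, hM⟩ := hb
  refine ⟨‖(2 * Real.pi * Complex.I : ℂ)⁻¹‖ * M, max A 0 + 2, fun z hz => ?_⟩
  rw [Derivative.normalizedDerivOfComplex, norm_mul]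
  gcongr
  exact norm_deriv_comp_ofComplex_le hf (le_max_right A 0)
    (fun w hw => hM w ((le_max_left A 0).trans hw)) (by linarith)

theorem isBoundedAtImInfty_serreDerivative (k : ℂ) {f : ℍ → ℂ}
    (hf : MDifferentiable 𝓘(ℂ) 𝓘(ℂ) f) (hb : IsBoundedAtImInfty f) :
    IsBoundedAtImInfty (Derivative.serreDerivative k f) := by
  have hsplit : Derivative.serreDerivative k f = Derivative.normalizedDerivOfComplex f +
      -((k * 12⁻¹) • (EisensteinSeries.E2 * f)) := by
    ext z
    simp [sub_eq_add_neg, mul_assoc]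
  rw [hsplit]
  exact (isBoundedAtImInfty_normalizedDerivOfComplex hf hb).add
    ((EisensteinSeries.isBoundedAtImInfty_E2.mul hb).smul (k * 12⁻¹)).neg

/-- The Serre derivative `D_k f` of a modular form `f` of weight `k` and level one, as a modular
form of weight `k + 2`. -/
def serreForm {k : ℤ} (f : ModularForm 𝒮ℒ k) : ModularForm 𝒮ℒ (k + 2) where
  toFun := Derivative.serreDerivative k f
  slash_action_eq' := fun _ ⟨γ, hγ⟩ => hγ ▸
    Derivative.serreDerivative_slash_invariant f.holo' (f.slash_action_eq' _ ⟨γ, rfl⟩)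
  holo' := Derivative.serreDerivative_mdifferentiable _ f.holo'
  bdd_at_cusps' {c} hc := by
    rw [Subgroup.IsArithmetic.isCusp_iff_isCusp_SL2Z] at hc
    rw [OnePoint.isBoundedAt_iff_forall_SL2Z hc]
    intro γ _
    have hinv : Derivative.serreDerivative (k : ℂ) f ∣[k + 2] γ =
        Derivative.serreDerivative (k : ℂ) f :=
      Derivative.serreDerivative_slash_invariant f.holo' (f.slash_action_eq' _ ⟨γ, rfl⟩)
    rw [hinv]
    exact isBoundedAtImInfty_serreDerivative _ f.holo' (ModularFormClass.bdd_at_infty f)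

end LevelOne

section DFinite

theorem exists_mem_span_range_fin {A M : Type*} [Semiring A] [AddCommMonoid M] [Module A M]
    [IsNoetherian A M] (u : ℕ → M) :
    ∃ n, u n ∈ Submodule.span A (Set.range fun i : Fin n => u i) := by
  let F : ℕ →o Submodule A M :=
    { toFun := fun n => Submodule.span A (Set.range fun i : Fin n => u i)
      monotone' := fun m n hmn => Submodule.span_mono <|
        Set.range_subset_iff.mpr fun i => ⟨Fin.castLE hmn i, rfl⟩ }
  obtain ⟨n, hn⟩ := monotone_stabilizes_iff_noetherian.mpr ‹IsNoetherian A M› F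
  have hmem : u n ∈ F (n + 1) := Submodule.subset_span ⟨Fin.last n, rfl⟩
  exact ⟨n, (hn (n + 1) n.le_succ).ge hmem⟩

variable {K C : Type*}

section CommSemiring

variable [CommSemiring K] [CommSemiring C] [Algebra K C]

/-- `x` is `D`-finite over the subalgebra `A`: it lies in a finitely generated `A`-submodule which
is stable under the derivation `D`. When `A` is noetherian and stable under `D`, this is the
coordinate-free form of solving a monic linear differential equation with coefficients in `A`. -/
def IsDFinite (A : Subalgebra K C) (D : Derivation K C C) (x : C) : Prop :=
  ∃ M : Submodule A C, M.FG ∧ (∀ y ∈ M, D y ∈ M) ∧ x ∈ M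

variable {A : Subalgebra K C} {D : Derivation K C C}

theorem derivation_mem_span (hA : ∀ a ∈ A, D a ∈ A) {s : Set C}
    (hs : ∀ x ∈ s, D x ∈ Submodule.span A s) {y : C} (hy : y ∈ Submodule.span A s) :
    D y ∈ Submodule.span A s := by
  induction hy using Submodule.span_induction with
  | mem y hy => exact hs y hy
  | zero => simp only [map_zero, zero_mem]
  | add y z _ _ hy hz => exact map_add D y z ▸ add_mem hy hz
  | smul a y hys hy =>
    rw [Subalgebra.smul_def, smul_eq_mul, D.leibniz, smul_eq_mul, smul_eq_mul, mul_comm y]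
    exact add_mem (Submodule.smul_mem _ a hy) (Submodule.smul_mem _ ⟨D a, hA a a.2⟩ hys)

theorem isDFinite_of_mem (hA : ∀ a ∈ A, D a ∈ A) {x : C} (hx : x ∈ A) : IsDFinite A D x := by
  refine ⟨Submodule.span A {1}, Submodule.fg_span_singleton 1, fun y => derivation_mem_span hA ?_,
    Submodule.mem_span_singleton.mpr ⟨⟨x, hx⟩, mul_one x⟩⟩
  rintro _ rfl
  exact D.map_one_eq_zero ▸ zero_mem _

theorem IsDFinite.add {x y : C} (hx : IsDFinite A D x) (hy : IsDFinite A D y) :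
    IsDFinite A D (x + y) := by
  obtain ⟨M, hM, hDM, hxM⟩ := hx
  obtain ⟨N, hN, hDN, hyN⟩ := hy
  refine ⟨M ⊔ N, hM.sup hN, fun z hz => ?_, Submodule.add_mem_sup hxM hyN⟩
  obtain ⟨u, hu, v, hv, rfl⟩ := Submodule.mem_sup.mp hz
  exact map_add D u v ▸ Submodule.add_mem_sup (hDM u hu) (hDN v hv)

theorem IsDFinite.mul {x y : C} (hx : IsDFinite A D x) (hy : IsDFinite A D y) :
    IsDFinite A D (x * y) := by
  obtain ⟨M, hM, hDM, hxM⟩ := hx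
  obtain ⟨N, hN, hDN, hyN⟩ := hy
  refine ⟨M * N, hM.mul hN, fun z hz => ?_, Submodule.mul_mem_mul hxM hyN⟩
  induction hz using Submodule.mul_induction_on' with
  | mem_mul_mem u hu v hv =>
    rw [D.leibniz, smul_eq_mul, smul_eq_mul, mul_comm v]
    exact add_mem (Submodule.mul_mem_mul hu (hDN v hv)) (Submodule.mul_mem_mul (hDM u hu) hv)
  | add u _ v _ hu hv => exact map_add D u v ▸ add_mem hu hv

theorem IsDFinite.derivation {x : C} (hx : IsDFinite A D x) : IsDFinite A D (D x) :=
  let ⟨M, hM, hDM, hxM⟩ := hx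
  ⟨M, hM, hDM, hDM x hxM⟩

/-- The subalgebra of the elements which are `D`-finite over a `D`-stable subalgebra `A`. -/
def dFiniteSubalgebra (hA : ∀ a ∈ A, D a ∈ A) : Subalgebra K C where
  carrier := {x | IsDFinite A D x}
  mul_mem' := IsDFinite.mul
  add_mem' := IsDFinite.add
  algebraMap_mem' r := isDFinite_of_mem hA (A.algebraMap_mem r)

end CommSemiring

section CommRing

variable [CommRing K] [CommRing C] [Algebra K C] {A : Subalgebra K C} {D : Derivation K C C}

theorem isDFinite_of_equation (hA : ∀ a ∈ A, D a ∈ A) {x : C} {n : ℕ} (c : Fin n → A)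
    (hx : D^[n] x + ∑ i : Fin n, (c i : C) * D^[i] x = 0) : IsDFinite A D x := by
  set M : Submodule A C := Submodule.span A (Set.range fun i : Fin n => D^[i] x)
  have hlt (i : Fin n) : D^[i] x ∈ M := Submodule.subset_span ⟨i, rfl⟩
  have hle {i : ℕ} (hi : i ≤ n) : D^[i] x ∈ M := by
    rcases hi.lt_or_eq with hi | rfl
    · exact hlt ⟨i, hi⟩
    · rw [eq_neg_of_add_eq_zero_left hx]
      exact neg_mem (sum_mem fun j _ => M.smul_mem (c j) (hlt j))
  refine ⟨M, Submodule.fg_span (Set.finite_range _), fun y => derivation_mem_span hA ?_,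
    hle n.zero_le⟩
  rintro _ ⟨i, rfl⟩
  exact Function.iterate_succ_apply' D i x ▸ hle i.2

theorem IsDFinite.exists_equation [IsNoetherianRing A] {x : C} (hx : IsDFinite A D x) :
    ∃ (n : ℕ) (c : Fin n → A), D^[n] x + ∑ i : Fin n, (c i : C) * D^[i] x = 0 := by
  obtain ⟨M, hM, hDM, hxM⟩ := hx
  have : IsNoetherian A M := isNoetherian_of_fg_of_noetherian M hM
  have hmem (i : ℕ) : D^[i] x ∈ M := Set.MapsTo.iterate hDM i hxM
  obtain ⟨n, hn⟩ := exists_mem_span_range_fin (A := A) fun i => (⟨D^[i] x, hmem i⟩ : M)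
  obtain ⟨c, hc⟩ := (Submodule.mem_span_range_iff_exists_fun A).mp hn
  have hcx : ∑ i : Fin n, (c i : C) * D^[i] x = D^[n] x := by
    simpa only [Submodule.coe_sum, Submodule.coe_smul, Subalgebra.smul_def, smul_eq_mul] using
      congrArg Subtype.val hc
  exact ⟨n, -c, by simp [hcx]⟩

theorem isDFinite_iff_exists_equation [IsNoetherianRing A] (hA : ∀ a ∈ A, D a ∈ A) {x : C} :
    IsDFinite A D x ↔
      ∃ (n : ℕ) (c : Fin n → A), D^[n] x + ∑ i : Fin n, (c i : C) * D^[i] x = 0 :=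
  ⟨IsDFinite.exists_equation, fun ⟨_, c, hx⟩ => isDFinite_of_equation hA c hx⟩

end CommRing

end DFinite

theorem mem_homogeneousCore_iff {ι σ B : Type*} [AddMonoid ι] [DecidableEq ι] [Semiring B]
    [SetLike σ B] [AddSubmonoidClass σ B] (𝒜 : ι → σ) [GradedRing 𝒜] {T : Subsemiring B} {x : B} :
    x ∈ T.homogeneousCore 𝒜 ↔ ∀ i, (DirectSum.decompose 𝒜 x i : B) ∈ T := by
  classical
  refine ⟨fun hx i => T.toSubsemiring_homogeneousCore_le 𝒜
    ((T.homogeneousCore 𝒜).isHomogeneous i hx), fun hx => ?_⟩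
  rw [← DirectSum.sum_support_decompose 𝒜 x]
  exact sum_mem fun i _ => Subsemiring.subset_closure
    ⟨⟨_, i, SetLike.coe_mem _⟩, hx i, rfl⟩

section Operators

open DirectSum ModularForm

/-- The embedding of the modular forms of weight `k` and level one into `H`, `f ↦ (f, k)`. -/
def weightEmbedding (k : ℤ) : ModularForm 𝒮ℒ k →ₗ[ℂ] H where
  toFun f := hom (ofModularForm f) k
  map_add' f g := AddMonoidAlgebra.single_add _ (ofModularForm f) (ofModularForm g)
  map_smul' c f := (AddMonoidAlgebra.smul_single c _ (ofModularForm f)).symm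

/-- The embedding of the graded ring of modular forms of level one into `H`. -/
def modularFormHom : (⨁ k, ModularForm 𝒮ℒ k) →ₐ[ℂ] H :=
  toAlgebra ℂ (ModularForm 𝒮ℒ) weightEmbedding
    (by
      change hom 1 ((0 : ℤ) : ℝ) = 1
      rw [Int.cast_zero]
      rfl)
    (fun {k l} f g => by
      change hom (ofModularForm f * ofModularForm g) ((k + l : ℤ) : ℝ) =
        hom (ofModularForm f) k * hom (ofModularForm g) l
      rw [AddMonoidAlgebra.single_mul_single, Int.cast_add])

theorem modularFormHom_of {k : ℤ} (f : ModularForm 𝒮ℒ k) :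
    modularFormHom (of (ModularForm 𝒮ℒ) k f) = hom (ofModularForm f) k :=
  toModule_lof ℂ k f

/-- The ring of modular forms of level one, as a subalgebra of `H`. -/
def modularFormRing : Subalgebra ℂ H := modularFormHom.range

theorem hom_ofModularForm_mem {k : ℤ} (f : ModularForm 𝒮ℒ k) :
    hom (ofModularForm f) k ∈ modularFormRing :=
  ⟨_, modularFormHom_of f⟩

theorem modularFormRing_eq_adjoin :
    modularFormRing = Algebra.adjoin ℂ {hom (ofModularForm E₄) 4, hom (ofModularForm E₆) 6} := by
  rw [modularFormRing, ← Algebra.map_top, ← adjoin_E₄_E₆_eq_top, AlgHom.map_adjoin,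
    Set.image_pair, modularFormHom_of, modularFormHom_of, Int.cast_ofNat, Int.cast_ofNat]

instance : IsNoetherianRing modularFormRing :=
  isNoetherianRing_of_fg (R := ℂ) (A := H) <|
    Subalgebra.fg_def.mpr ⟨_, Set.toFinite _, modularFormRing_eq_adjoin.symm⟩

theorem map_lmul_modularFormRing : modularFormRing.map (Algebra.lmul ℂ H) = coeffAlg := by
  rw [modularFormRing_eq_adjoin, AlgHom.map_adjoin, Set.image_pair]
  rfl

theorem serreD_mul (m n : ℝ) (f g : Hol) :
    serreD (m + n) (f * g) = serreD m f * g + f * serreD n g := by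
  have h := Derivative.serreDerivative_mul m n f.1 g.1 f.2 g.2
  rw [← Complex.ofReal_add] at h
  exact Subtype.ext h

theorem delta_mul (φ ψ : H) : delta (φ * ψ) = φ * delta ψ + ψ * delta φ := by
  induction φ using AddMonoidAlgebra.induction_linear with
  | zero => simp only [zero_mul, mul_zero, map_zero, add_zero]
  | add φ₁ φ₂ h₁ h₂ =>
    rw [add_mul, map_add, map_add, h₁, h₂, add_mul, mul_add]
    abel
  | single m f =>
    induction ψ using AddMonoidAlgebra.induction_linear with
    | zero => simp only [zero_mul, mul_zero, map_zero, add_zero]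
    | add ψ₁ ψ₂ h₁ h₂ =>
      rw [mul_add, map_add, map_add, h₁, h₂, mul_add, add_mul]
      abel
    | single n g =>
      have hsplit : hom (serreD (m + n) (f * g)) (m + n + 2) =
          hom (f * serreD n g) (m + (n + 2)) + hom (g * serreD m f) (n + (m + 2)) := by
        rw [serreD_mul, add_comm, mul_comm g, add_left_comm n, ← add_assoc]
        exact AddMonoidAlgebra.single_add ..
      simpa only [AddMonoidAlgebra.single_mul_single, delta_hom] using hsplit

/-- `delta` as a derivation of the algebra `H`. -/
def deltaDerivation : Derivation ℂ H H := Derivation.mk' (R := ℂ) (A := H) (M := H) delta delta_mul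

theorem delta_hom_ofModularForm {k : ℤ} (f : ModularForm 𝒮ℒ k) :
    delta (hom (ofModularForm f) k) = hom (ofModularForm (serreForm f)) ((k + 2 : ℤ) : ℝ) := by
  rw [delta_hom, Int.cast_add, Int.cast_ofNat]
  rfl

theorem delta_mem_modularFormRing {φ : H} (hφ : φ ∈ modularFormRing) :
    delta φ ∈ modularFormRing := by
  obtain ⟨f, rfl⟩ := hφ
  induction f using DirectSum.induction_on with
  | zero => simp only [map_zero, zero_mem]
  | of k f =>
    change delta (modularFormHom (of _ k f)) ∈ modularFormRing
    rw [modularFormHom_of, delta_hom_ofModularForm]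
    exact hom_ofModularForm_mem _
  | add f g hf hg =>
    rw [map_add, map_add]
    exact add_mem hf hg

theorem hom_coeff_delta (φ : H) (k : ℝ) :
    hom ((delta φ).coeff k) k = delta (hom (φ.coeff (k - 2)) (k - 2)) := by
  rw [delta_hom, sub_add_cancel]
  induction φ using AddMonoidAlgebra.induction_linear with
  | zero => simp
  | add φ ψ hφ hψ => simp_all
  | single n f =>
    rw [delta_hom]
    obtain rfl | hk := eq_or_ne k (n + 2)
    · simp
    · have hne : n ≠ k - 2 := fun h => hk (sub_eq_iff_eq_add.mp h.symm)
      simp [hk.symm, hne]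

theorem decompose_grade_eq_hom (φ : H) (k : ℝ) :
    (decompose (AddMonoidAlgebra.grade Hol) φ k : H) = hom (φ.coeff k) k := by
  induction φ using AddMonoidAlgebra.induction_linear with
  | zero => simp
  | add φ ψ hφ hψ => simp_all
  | single n f =>
    rw [AddMonoidAlgebra.grade.decompose_single]
    obtain rfl | hk := eq_or_ne k n
    · simp
    · simp [of_eq_of_ne, hk]

theorem apply_mem_of_mem_R {B : Subalgebra ℂ H} (hδ : ∀ φ ∈ B, delta φ ∈ B)
    (hB : modularFormRing ≤ B) {a : Module.End ℂ H} (ha : a ∈ R) {φ : H} (hφ : φ ∈ B) :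
    a φ ∈ B := by
  induction ha using Algebra.adjoin_induction generalizing φ with
  | mem a ha =>
    rcases ha with rfl | rfl | rfl
    · exact hδ φ hφ
    · exact mul_mem (hB (by simpa using hom_ofModularForm_mem E₄)) hφ
    · exact mul_mem (hB (by simpa using hom_ofModularForm_mem E₆)) hφ
  | algebraMap c => exact B.smul_mem hφ c
  | add a b _ _ ha hb => exact add_mem (ha hφ) (hb hφ)
  | mul _ b _ _ ha hb => exact ha (hb hφ)

theorem isMonic_iff {a : Module.End ℂ H} :
    IsMonic a ↔ ∃ (n : ℕ) (c : Fin n → modularFormRing),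
      a = delta ^ n + ∑ i : Fin n, Algebra.lmul ℂ H (c i) * delta ^ (i : ℕ) := by
  constructor
  · rintro ⟨n, c, rfl⟩
    have hc (i : Fin n) : ∃ b : modularFormRing, Algebra.lmul ℂ H b = c i := by
      obtain ⟨b, hb, hbc⟩ := map_lmul_modularFormRing.ge (c i).2
      exact ⟨⟨b, hb⟩, hbc⟩
    choose b hb using hc
    exact ⟨n, b, by simp only [hb]⟩
  · rintro ⟨n, c, rfl⟩
    exact ⟨n, fun i => ⟨_, map_lmul_modularFormRing.le ⟨c i, (c i).2, rfl⟩⟩, rfl⟩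

theorem IsMonic.mem_R {a : Module.End ℂ H} (ha : IsMonic a) : a ∈ R := by
  obtain ⟨n, c, rfl⟩ := ha
  have hδ : delta ∈ R := Algebra.subset_adjoin (by simp)
  have hle : coeffAlg ≤ R := Algebra.adjoin_mono (by simp)
  exact add_mem (pow_mem hδ n) (sum_mem fun i _ => mul_mem (hle (c i).2) (pow_mem hδ i))

/-- The algebra of the elements of `H` which are `δ`-finite over the ring of modular forms. -/
def deltaFinite : Subalgebra ℂ H :=
  dFiniteSubalgebra (A := modularFormRing) (D := deltaDerivation) fun _ => delta_mem_modularFormRing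

theorem mem_S_iff {k : ℝ} {φ : H} : φ ∈ S k ↔ φ ∈ degH k ∧ φ ∈ deltaFinite := by
  have hfin : φ ∈ deltaFinite ↔ ∃ (n : ℕ) (c : Fin n → modularFormRing),
      deltaDerivation^[n] φ + ∑ i : Fin n, (c i : H) * deltaDerivation^[i] φ = 0 :=
    isDFinite_iff_exists_equation (K := ℂ) (C := H) fun _ => delta_mem_modularFormRing
  have happly (n : ℕ) (c : Fin n → modularFormRing) :
      (delta ^ n + ∑ i : Fin n, Algebra.lmul ℂ H (c i) * delta ^ (i : ℕ)) φ =
        deltaDerivation^[n] φ + ∑ i : Fin n, (c i : H) * deltaDerivation^[i] φ := by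
    simp only [LinearMap.add_apply, LinearMap.sum_apply, Module.End.mul_apply, Module.End.pow_apply]
    rfl
  refine and_congr_right fun _ => ⟨?_, fun hφ => ?_⟩
  · rintro ⟨a, _, ha, haφ⟩
    obtain ⟨n, c, rfl⟩ := isMonic_iff.mp ha
    exact hfin.mpr ⟨n, c, happly n c ▸ haφ⟩
  · obtain ⟨n, c, hφ⟩ := hfin.mp hφ
    have ha := isMonic_iff.mpr ⟨n, c, rfl⟩
    exact ⟨_, ha.mem_R, ha, (happly n c).trans hφ⟩

theorem modularFormRing_le_deltaFinite : modularFormRing ≤ deltaFinite :=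
  fun _ => isDFinite_of_mem fun _ => delta_mem_modularFormRing

theorem add_mem_S {k : ℝ} {φ ψ : H} (hφ : φ ∈ S k) (hψ : ψ ∈ S k) : φ + ψ ∈ S k := by
  rw [mem_S_iff] at *
  obtain ⟨⟨f, rfl⟩, hf⟩ := hφ
  obtain ⟨⟨g, rfl⟩, hg⟩ := hψ
  exact ⟨⟨f + g, AddMonoidAlgebra.single_add ..⟩, add_mem hf hg⟩

theorem mul_mem_S {k l : ℝ} {φ ψ : H} (hφ : φ ∈ S k) (hψ : ψ ∈ S l) : φ * ψ ∈ S (k + l) := by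
  rw [mem_S_iff] at *
  obtain ⟨⟨f, rfl⟩, hf⟩ := hφ
  obtain ⟨⟨g, rfl⟩, hg⟩ := hψ
  exact ⟨⟨f * g, (AddMonoidAlgebra.single_mul_single ..).symm⟩, mul_mem hf hg⟩

theorem apply_mem_S {k : ℤ} {l : ℝ} {a : Module.End ℂ H} (ha : a ∈ degR k) {φ : H}
    (hφ : φ ∈ S l) : a φ ∈ S (k + l) := by
  rw [mem_S_iff, add_comm] at *
  exact ⟨ha.2 l φ hφ.1, apply_mem_of_mem_R (fun _ => IsDFinite.derivation)
    modularFormRing_le_deltaFinite ha.1 hφ.2⟩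

theorem modularForms_subset_S (k : ℤ) : modularForms k ⊆ S k := by
  rintro _ ⟨f, rfl⟩
  exact mem_S_iff.mpr ⟨⟨_, rfl⟩, modularFormRing_le_deltaFinite (hom_ofModularForm_mem f)⟩

theorem mem_sumS_iff {φ : H} : φ ∈ sumS ↔
    φ ∈ deltaFinite.toSubsemiring.homogeneousCore (AddMonoidAlgebra.grade Hol) := by
  rw [mem_homogeneousCore_iff]
  refine forall_congr' fun k => ?_
  rw [decompose_grade_eq_hom, mem_S_iff]
  exact and_iff_right ⟨_, rfl⟩

theorem S_subset_sumS (k : ℝ) : S k ⊆ sumS := by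
  intro φ hφ
  obtain ⟨⟨f, rfl⟩, hf⟩ := mem_S_iff.mp hφ
  exact mem_sumS_iff.mpr <| Subsemiring.subset_closure
    ⟨⟨_, k, AddMonoidAlgebra.single_mem_grade k f⟩, hf, rfl⟩

/-- The direct sum `⨁_{k ∈ ℝ} S_k`, as a subalgebra of `H`. -/
def solutionAlgebra : Subalgebra ℂ H where
  carrier := sumS
  add_mem' hφ hψ := by
    rw [mem_sumS_iff] at *
    exact add_mem hφ hψ
  mul_mem' hφ hψ := by
    rw [mem_sumS_iff] at *
    exact mul_mem hφ hψ
  algebraMap_mem' c := S_subset_sumS 0 <|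
    mem_S_iff.mpr ⟨⟨algebraMap ℂ Hol c, rfl⟩, deltaFinite.algebraMap_mem c⟩

theorem modularFormRing_le_solutionAlgebra : modularFormRing ≤ solutionAlgebra := by
  rw [modularFormRing_eq_adjoin, Algebra.adjoin_le_iff, Set.insert_subset_iff,
    Set.singleton_subset_iff]
  exact ⟨S_subset_sumS 4 (by simpa using modularForms_subset_S 4 ⟨E₄, rfl⟩),
    S_subset_sumS 6 (by simpa using modularForms_subset_S 6 ⟨E₆, rfl⟩)⟩

theorem delta_mem_solutionAlgebra {φ : H} (hφ : φ ∈ solutionAlgebra) :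
    delta φ ∈ solutionAlgebra := fun k => by
  rw [hom_coeff_delta, mem_S_iff]
  refine ⟨?_, IsDFinite.derivation (mem_S_iff.mp (hφ (k - 2))).2⟩
  rw [delta_hom, sub_add_cancel]
  exact ⟨_, rfl⟩

/-- The direct sum `⨁_{k ∈ ℝ} S_k`, as a left `R`-submodule of `H`. -/
def solutionModule : Submodule R H where
  __ := solutionAlgebra.toSubmodule.toAddSubmonoid
  smul_mem' a _ hφ := apply_mem_of_mem_R (fun _ => delta_mem_solutionAlgebra)
    modularFormRing_le_solutionAlgebra a.2 hφ

end Operators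

end MLDO

end

theorem mainTheorem6 :
    (∀ k : ℝ, MLDO.S k + MLDO.S k ⊆ MLDO.S k) ∧
    (∀ k l : ℝ, MLDO.S k * MLDO.S l ⊆ MLDO.S (k + l)) ∧
    (∀ (k : ℤ) (l : ℝ), ∀ a ∈ MLDO.degR k, ∀ φ ∈ MLDO.S l, a φ ∈ MLDO.S (k + l)) ∧
    (∀ k : ℤ, MLDO.modularForms k ⊆ MLDO.S k) ∧
    (∃ A : Subalgebra ℂ MLDO.H, (A : Set MLDO.H) = MLDO.sumS) ∧
    (∃ N : Submodule MLDO.R MLDO.H, (N : Set MLDO.H) = MLDO.sumS) := by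
  refine ⟨?_, ?_, fun _ _ _ ha _ hφ => MLDO.apply_mem_S ha hφ, MLDO.modularForms_subset_S,
    ⟨MLDO.solutionAlgebra, rfl⟩, ⟨MLDO.solutionModule, rfl⟩⟩
  · rintro k _ ⟨φ, hφ, ψ, hψ, rfl⟩
    exact MLDO.add_mem_S hφ hψ
  · rintro k l _ ⟨φ, hφ, ψ, hψ, rfl⟩
    exact MLDO.mul_mem_S hφ hψ
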